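/- Let $D=\mathbb{R}[x^{1/n}\mid n\ge 1]$ be the ring of finite sums $\sum_q r_q x^q$ with real coefficients and exponents in $\mathbb{Q}_{\ge 0}$, let $Q=\langle x^{1/n}\mid n\ge 1\rangle\subseteq D$, let $V=D_Q$ with maximal ideal $M$, let $R=\mathbb{Q}+M\subseteq V$, and let $\mathfrak m=M$, regarded as an ideal of $R$. Definitions. A module $X$ over a commutative ring is coherent if it is finitely generated and all its finitely generated submodules are finitely presented; a ring is coherent if it is coherent as a module over itself. A domain $A$ with fraction field $K$ is a pseudo-valuation domain if for every prime ideal $P$ and all $x,y\in K$, $xy\in P$ implies $x\in P$ or $y\in P$. An $R$-module $X$ is almost zero if $\mathfrak m X=0$; $\mathrm{Mod}_R^a$ is the Serre quotient of the category of $R$-modules by the almost zero modules, and $X\mapsto X^a$ is the localization functor. Modules $X,Y$ are almost isomorphic if $X^a\cong Y^a$. $X$ is almost finitely generated if for every $s\in\mathfrak m$ there is $f:R^n\to X$ with $s\,\mathrm{Coker} f=0$; it is almost finitely presented if for all $s,t\in\mathfrak m$ there is a complex $R^m\xrightarrow{g}R^n\xrightarrow{f}X$ with $s\,\mathrm{Coker}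 f=0$ and $t\,\mathrm{Ker} f\subseteq \mathrm{Im}\, g$. $X$ is almost coherent if it is almost finitely generated and every $R$-module $N$ that is almost finitely generated and admits a monomorphism $N^a\hookrightarrow X^a$ in $\mathrm{Mod}_R^a$ is almost finitely presented. $R$ is almost Noetherian if every ideal of $R$ is almost finitely generated. Then: 1. $Q$ is a maximal ideal of $D$, and $V$ is a valuation domain with value group $\mathbb{Q}$. 2. $R$ is a local pseudo-valuation domain with maximal ideal $\mathfrak m$, which is its only nonzero prime ideal; $R$ has Krull dimension $1$; $R$ is not coherent; $\mathfrak m$ is not finitely generated; $\mathfrak m^2=\mathfrak m$; and $\mathfrak m$ and $\mathfrak m\otimes_R\mathfrak m$ are flat $R$-modules. 3. $R$ is almost Noetherian, and $R$ is almost coherent as an $R$-module. 4. No coherent $R$-module is almost isomorphic to $R$. So an almost coherent module need not be almost isomorphic to a coherent one. 5. It is not the case that for every finitely generated ideal $\mathfrak m_0\subseteq\mathfrak m$ there are a coherent $R$-module $N$ and an $R$-linear map $f:N\to R$ with $\mathfrak m_0\,\mathrm{Ker} f=0$ and $\mathfrak m_0\,\mathrm{Coker} f=0$. As $R$ is almost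 coherent, this answers negatively Zavyalov's Question 2.6.6, which asks whether every almost coherent module admits such approximations by coherent modules. -/

import Mathlib

open CategoryTheory
open scoped TensorProduct NNRat

universe u

/-! ## Coherent modules, pseudo-valuation domains -/

/-- A module is coherent if it is finitely generated and each of its finitely generated
submodules is finitely presented. -/
def IsCoherentModule (R : Type u) [CommRing R] (M : Type u) [AddCommGroup M] [Module R M] :
    Prop :=
  Module.Finite R M ∧ ∀ N : Submodule R M, N.FG → Module.FinitePresentation R N

/-- A commutative ring is coherent if it is a coherent module over itself. -/
def IsCoherentRing (R : Type u) [CommRing R] : Prop :=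
  IsCoherentModule R R

/-- A pseudo-valuation domain: a domain `A` such that every prime ideal `P` is strongly prime,
i.e. for `x`, `y` in the fraction field, `x * y ∈ P` implies `x ∈ P` or `y ∈ P`. -/
def IsPseudoValuationDomain (A : Type u) [CommRing A] [IsDomain A] : Prop :=
  ∀ P : Ideal A, P.IsPrime → ∀ x y : FractionRing A,
    x * y ∈ algebraMap A (FractionRing A) '' (P : Set A) →
      x ∈ algebraMap A (FractionRing A) '' (P : Set A) ∨
        y ∈ algebraMap A (FractionRing A) '' (P : Set A)

/-! ## Almost mathematics over a ring `R` with an idempotent ideal `𝔪` -/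

namespace AlmostMath

section

variable {R : Type u} [CommRing R] (𝔪 : Ideal R)

/-- The almost zero modules, i.e. those with `𝔪 M = 0`. -/
def almostZero : ObjectProperty (ModuleCat.{u} R) :=
  fun M => 𝔪 • (⊤ : Submodule R M) = ⊥

theorem almostZero_iff (M : ModuleCat.{u} R) :
    almostZero 𝔪 M ↔ ∀ s ∈ 𝔪, ∀ x : M, s • x = 0 := by
  unfold almostZero
  rw [eq_bot_iff, Submodule.smul_le]
  exact ⟨fun h s hs x => (Submodule.mem_bot R).1 (h s hs x trivial),
    fun h s hs x _ => (Submodule.mem_bot R).2 (h s hs x)⟩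

/-- Almost zero modules form a Serre subcategory, since `𝔪` is idempotent. -/
instance almostZero_isSerreClass [h𝔪 : Fact (𝔪 * 𝔪 = 𝔪)] :
    (almostZero 𝔪).IsSerreClass where
  exists_zero := ⟨.of R PUnit, ModuleCat.isZero_of_subsingleton _, by
    rw [almostZero_iff]; intro s _ x; exact Subsingleton.elim _ _⟩
  prop_of_mono {M N} f hf hN := by
    rw [ModuleCat.mono_iff_injective] at hf
    rw [almostZero_iff] at hN ⊢
    intro s hs x
    apply hf
    rw [map_smul, map_zero]
    exact hN s hs (f x)
  prop_of_epi {M N} f hf hM := by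
    rw [ModuleCat.epi_iff_surjective] at hf
    rw [almostZero_iff] at hM ⊢
    intro s hs y
    obtain ⟨x, rfl⟩ := hf y
    rw [← map_smul, hM s hs x, map_zero]
  prop_X₂_of_shortExact {S} hS h₁ h₃ := by
    rw [almostZero_iff] at h₁ h₃ ⊢
    intro s hs x
    rw [← h𝔪.out] at hs
    induction hs using Submodule.mul_induction_on' with
    | mem_mul_mem a ha b hb =>
      have hb0 : S.g (b • x) = 0 := by rw [map_smul, h₃ b hb]
      obtain ⟨y, hy⟩ := (S.moduleCat_exact_iff.1 hS.exact) (b • x) hb0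
      rw [mul_smul, ← hy, ← map_smul, h₁ a ha, map_zero]
    | add a _ b _ ha hb => rw [add_smul, ha, hb, add_zero]

/-- The category of almost modules: the Serre quotient of all modules by the almost zero ones,
i.e. the localization at the morphisms with almost zero kernel and cokernel. -/
abbrev AlmostMod [Fact (𝔪 * 𝔪 = 𝔪)] :=
  (almostZero 𝔪).isoModSerre.Localization

/-- The localization functor `M ↦ Mᵃ`. -/
abbrev toAlmost [Fact (𝔪 * 𝔪 = 𝔪)] : ModuleCat.{u} R ⥤ AlmostMod 𝔪 :=
  (almostZero 𝔪).isoModSerre.Q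

/-- Two modules are almost isomorphic if they become isomorphic in the category of almost
modules. -/
def AlmostIsomorphic [Fact (𝔪 * 𝔪 = 𝔪)] (M N : ModuleCat.{u} R) : Prop :=
  Nonempty ((toAlmost 𝔪).obj M ≅ (toAlmost 𝔪).obj N)

/-- Almost finitely generated: for every `s ∈ 𝔪` there is `f : Rⁿ → M` whose cokernel is killed
by `s`. -/
def IsAlmostFG (M : Type u) [AddCommGroup M] [Module R M] : Prop :=
  ∀ s ∈ 𝔪, ∃ (n : ℕ) (f : (Fin n → R) →ₗ[R] M), ∀ x : M, s • x ∈ LinearMap.range f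

/-- Almost finitely presented: for all `s, t ∈ 𝔪` there is a complex `Rᵐ → Rⁿ → M` with maps
`g`, `f` such that `Coker f` is killed by `s` and `t Ker f ⊆ Im g`. -/
def IsAlmostFP (M : Type u) [AddCommGroup M] [Module R M] : Prop :=
  ∀ s ∈ 𝔪, ∀ t ∈ 𝔪, ∃ (n m : ℕ) (f : (Fin n → R) →ₗ[R] M)
    (g : (Fin m → R) →ₗ[R] (Fin n → R)),
    f ∘ₗ g = 0 ∧ (∀ x : M, s • x ∈ LinearMap.range f) ∧
      ∀ y ∈ LinearMap.ker f, t • y ∈ LinearMap.range g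

/-- Almost coherent: `M` is almost finitely generated, and every almost submodule `Nᵃ ⊆ Mᵃ`
with `N` almost finitely generated is almost finitely presented. -/
def IsAlmostCoherent [Fact (𝔪 * 𝔪 = 𝔪)] (M : ModuleCat.{u} R) : Prop :=
  IsAlmostFG 𝔪 M ∧
    ∀ (N : ModuleCat.{u} R) (i : (toAlmost 𝔪).obj N ⟶ (toAlmost 𝔪).obj M),
      Mono i → IsAlmostFG 𝔪 N → IsAlmostFP 𝔪 N

/-- The ring `R` is almost Noetherian if each of its ideals is almost finitely generated. -/
def IsAlmostNoetherianRing : Prop :=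
  ∀ I : Ideal R, IsAlmostFG 𝔪 I

end

end AlmostMath

/-! ## The ring `ℚ + M` -/

namespace PVDExample

noncomputable section

/-- `D = ℝ[x^{1/n} | n ≥ 1]`, as the ring of finite sums `∑ r_q x^q` with nonnegative rational
exponents `q`; see `adjoin_xroot`. -/
abbrev D : Type := AddMonoidAlgebra ℝ ℚ≥0

/-- The element `x^{1/n}` of `D` (for `n ≥ 1`). -/
def xroot (n : ℕ) : D := AddMonoidAlgebra.single (1 / (n : ℚ≥0)) 1

theorem xroot_pow (n k : ℕ) :
    xroot n ^ k = AddMonoidAlgebra.single ((k : ℚ≥0) / n) (1 : ℝ) := by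
  rw [xroot, AddMonoidAlgebra.single_pow, one_pow, nsmul_eq_mul, mul_one_div]

/-- The ring `D` is generated over `ℝ` by the elements `x^{1/n}`, `n ≥ 1`. -/
theorem adjoin_xroot : Algebra.adjoin ℝ {d : D | ∃ n : ℕ, 1 ≤ n ∧ d = xroot n} = ⊤ := by
  rw [eq_top_iff]
  rintro d -
  induction d using AddMonoidAlgebra.induction_linear with
  | zero => exact zero_mem _
  | add a b ha hb => exact add_mem ha hb
  | single q r =>
    have h : (AddMonoidAlgebra.single q r : D) = r • xroot q.den ^ q.num := by
      rw [xroot_pow, NNRat.num_div_den, AddMonoidAlgebra.smul_single, smul_eq_mul, mul_one]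
    have hx : xroot q.den ∈ {d : D | ∃ n : ℕ, 1 ≤ n ∧ d = xroot n} := ⟨q.den, q.den_pos, rfl⟩
    rw [h]
    exact Subalgebra.smul_mem _ (pow_mem (Algebra.subset_adjoin hx) _) _

/-- The ideal `Q` of `D` generated by the elements `x^{1/n}`, `n ≥ 1`. -/
def Q : Ideal D := Ideal.span {d : D | ∃ n : ℕ, 1 ≤ n ∧ d = xroot n}

theorem xroot_mem {n : ℕ} (hn : 1 ≤ n) : xroot n ∈ Q := Ideal.subset_span ⟨n, hn, rfl⟩

theorem single_mem {q : ℚ≥0} (hq : q ≠ 0) (r : ℝ) : (AddMonoidAlgebra.single q r : D) ∈ Q := by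
  have h : (AddMonoidAlgebra.single q r : D)
      = (AddMonoidAlgebra.single 0 r * xroot q.den ^ (q.num - 1)) * xroot q.den := by
    have h0 : q.num ≠ 0 := by simpa using hq
    rw [mul_assoc, ← pow_succ, Nat.sub_add_cancel (Nat.one_le_iff_ne_zero.2 h0), xroot_pow,
      NNRat.num_div_den, AddMonoidAlgebra.single_mul_single, zero_add, mul_one]
  rw [h]
  exact Q.mul_mem_left _ (xroot_mem q.den_pos)

/-- The evaluation `x^q ↦ 0` (for `q > 0`), i.e. the constant coefficient. -/
def constCoeff : D →ₐ[ℝ] ℝ :=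
  AddMonoidAlgebra.lift ℝ ℝ ℚ≥0
    { toFun := fun q => if q.toAdd = 0 then 1 else 0
      map_one' := by simp
      map_mul' := by
        intro a b
        by_cases ha : a.toAdd = 0 <;> by_cases hb : b.toAdd = 0 <;> simp [ha, hb] }

theorem Q_eq_ker : Q = RingHom.ker constCoeff := by
  apply le_antisymm
  · rw [Q, Ideal.span_le]
    rintro _ ⟨n, hn, rfl⟩
    have hn' : (n : ℚ≥0) ≠ 0 := by exact_mod_cast (Nat.one_le_iff_ne_zero.1 hn)
    simp [RingHom.mem_ker, constCoeff, xroot]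
    omega
  · intro d hd
    have key : ∀ d : D, d - AddMonoidAlgebra.single 0 (constCoeff d) ∈ Q := by
      intro d
      induction d using AddMonoidAlgebra.induction_linear with
      | zero => simp
      | add a b ha hb =>
        have := add_mem ha hb
        rw [map_add, AddMonoidAlgebra.single_add]
        convert this using 1
        ring
      | single q r =>
        by_cases hq : q = 0
        · subst hq
          simp [constCoeff]
        · have : constCoeff (AddMonoidAlgebra.single q r) = 0 := by simp [constCoeff, hq]
          rw [this, AddMonoidAlgebra.single_zero, sub_zero]
          exact single_mem hq r
    have := key d
    rw [RingHom.mem_ker] at hd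
    simpa [hd] using this

instance Q_isMaximal : Q.IsMaximal := by
  rw [Q_eq_ker]
  exact RingHom.ker_isMaximal_of_surjective _ fun r =>
    ⟨algebraMap ℝ D r, constCoeff.commutes r⟩

instance Q_isPrime : Q.IsPrime := Q_isMaximal.isPrime

/-- The localization `V = D_Q`. -/
abbrev V : Type := Localization.AtPrime Q

/-- The maximal ideal `M` of `V`. -/
abbrev M : Ideal V := IsLocalRing.maximalIdeal V

/-- The subring `ℚ + M` of `V`. -/
def ratAddM : Subring V where
  carrier := {v | ∃ q : ℚ, ∃ m ∈ M, v = algebraMap ℝ V (q : ℝ) + m}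
  zero_mem' := ⟨0, 0, zero_mem _, by simp⟩
  one_mem' := ⟨1, 0, zero_mem _, by simp⟩
  add_mem' := by
    rintro _ _ ⟨q, m, hm, rfl⟩ ⟨q', m', hm', rfl⟩
    exact ⟨q + q', m + m', add_mem hm hm', by rw [Rat.cast_add, map_add]; ring⟩
  neg_mem' := by
    rintro _ ⟨q, m, hm, rfl⟩
    exact ⟨-q, -m, neg_mem hm, by rw [Rat.cast_neg, map_neg]; ring⟩
  mul_mem' := by
    rintro _ _ ⟨q, m, hm, rfl⟩ ⟨q', m', hm', rfl⟩
    refine ⟨q * q', algebraMap ℝ V (q : ℝ) * m' + algebraMap ℝ V (q' : ℝ) * m + m * m',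
      add_mem (add_mem (M.mul_mem_left _ hm') (M.mul_mem_left _ hm)) (M.mul_mem_left _ hm'), ?_⟩
    rw [Rat.cast_mul, map_mul]
    ring

/-- The ring `R = ℚ + M`. -/
abbrev R : Type := ratAddM

/-- `M`, regarded as an ideal of `R = ℚ + M`. -/
def 𝔪 : Ideal R := M.comap ratAddM.subtype

theorem mem_𝔪 (r : R) : r ∈ 𝔪 ↔ (r : V) ∈ M := Iff.rfl

/-- The maximal ideal `M` is contained in `R`. -/
theorem mem_ratAddM {v : V} (hv : v ∈ M) : v ∈ ratAddM := ⟨0, v, hv, by simp⟩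

theorem Q_mul_Q : Q * Q = Q := by
  refine le_antisymm Ideal.mul_le_left ?_
  conv_lhs => rw [Q]
  rw [Ideal.span_le]
  rintro _ ⟨n, hn, rfl⟩
  have h : xroot n = xroot (2 * n) * xroot (2 * n) := by
    have hn' : (n : ℚ≥0) ≠ 0 := by exact_mod_cast (Nat.one_le_iff_ne_zero.1 hn)
    rw [← pow_two, xroot_pow, xroot]
    congr 1
    push_cast
    field_simp
  rw [h]
  exact Ideal.mul_mem_mul (xroot_mem (by omega)) (xroot_mem (by omega))

theorem M_mul_M : M * M = M := by
  have h : M = Q.map (algebraMap D V) := (Localization.AtPrime.map_eq_maximalIdeal).symm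
  rw [h, ← Ideal.map_mul, Q_mul_Q]

instance 𝔪_idempotent : Fact (𝔪 * 𝔪 = 𝔪) := ⟨by
  refine le_antisymm Ideal.mul_le_left ?_
  have key : ∀ v ∈ M * M, ∀ hv : v ∈ ratAddM, (⟨v, hv⟩ : R) ∈ 𝔪 * 𝔪 := by
    intro v hv
    induction hv using Submodule.mul_induction_on' with
    | mem_mul_mem a ha b hb =>
      intro _
      exact Ideal.mul_mem_mul (I := 𝔪) (J := 𝔪) (r := ⟨a, mem_ratAddM ha⟩)
        (s := ⟨b, mem_ratAddM hb⟩) ha hb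
    | add a ha b hb iha ihb =>
      intro _
      exact add_mem (iha (mem_ratAddM (M_mul_M ▸ ha))) (ihb (mem_ratAddM (M_mul_M ▸ hb)))
  intro r hr
  exact key r (M_mul_M.symm ▸ hr) r.2⟩

end

end PVDExample

/-!
Every nonzero element of `V` is a power of `x` times a unit, so divisibility in `V` is total and is
measured by the exponent. In `R = ℚ + M` it is still total up to `𝔪`: if `a` does not divide `b`,
then `b` divides `a * m` for all `m ∈ 𝔪`. Together with `𝔪² = 𝔪` this makes `𝔪` a directed union of
the ideals `a𝔪`, hence flat, and every ideal of `R` almost principal: given `0 ≠ J` and `s ∈ 𝔪`,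
some `0 ≠ a ∈ J` divides `sJ`. A submodule of `R` is thus almost finitely free, and so is every
module whose almost module embeds in that of `R`.

On the other hand neither of `x`, `√2 x` divides the other in `R`, so the colon ideal of one by the
other is `𝔪`, which is not finitely generated; hence `R` is not coherent. If `N → R` has kernel and
cokernel killed by a regular element `c ∈ 𝔪`, then multiplication by powers of `c` embeds every
finitely generated ideal of `R` in `N`, so `N` is not coherent either.
-/

theorem IsCoherentModule.fg_colon_singleton {A : Type u} [CommRing A] {X : Type u}
    [AddCommGroup X] [Module A X] (hX : IsCoherentModule A X) {Y : Submodule A X} (hY : Y.FG)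
    (x : X) : (Y.colon {x}).FG := by
  obtain ⟨n, g, rfl⟩ := (Submodule.fg_iff_exists_fin_linearMap A X).1 hY
  let k : ((Fin n → A) × A) →ₗ[A] X := g.coprod (LinearMap.toSpanSingleton A X x)
  have hrange : Module.FinitePresentation A (LinearMap.range k) := hX.2 _ (Submodule.fg_range k)
  have hker : (LinearMap.ker k).FG :=
    k.ker_rangeRestrict ▸ Module.FinitePresentation.fg_ker _ k.surjective_rangeRestrict
  suffices h : (LinearMap.range g).colon {x} = (LinearMap.ker k).map (LinearMap.snd A _ A) from
    h ▸ hker.map _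
  ext t
  simp only [Submodule.mem_colon_singleton, LinearMap.mem_range, Submodule.mem_map,
    LinearMap.mem_ker, Prod.exists, LinearMap.snd_apply, exists_eq_right, k,
    LinearMap.coprod_apply, LinearMap.toSpanSingleton_apply]
  constructor
  · rintro ⟨v, hv⟩
    exact ⟨-v, by rw [map_neg, hv, neg_add_cancel]⟩
  · rintro ⟨v, hv⟩
    exact ⟨-v, by rw [map_neg, neg_eq_of_add_eq_zero_right hv]⟩

namespace AlmostMath

section

variable {A : Type u} [CommRing A] {I : Ideal A}

section LinearMap

variable {X Y : Type*} [AddCommGroup X] [Module A X] [AddCommGroup Y] [Module A Y]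

/-- A linear map is almost injective with respect to an ideal `I` if `I` annihilates its kernel. -/
def IsAlmostInjective (I : Ideal A) (f : X →ₗ[A] Y) : Prop :=
  ∀ s ∈ I, ∀ x, f x = 0 → s • x = 0

/-- A linear map is almost surjective with respect to an ideal `I` if `I` annihilates its
cokernel. -/
def IsAlmostSurjective (I : Ideal A) (f : X →ₗ[A] Y) : Prop :=
  ∀ s ∈ I, ∀ y, ∃ x, f x = s • y

theorem isAlmostInjective_id : IsAlmostInjective I (LinearMap.id : X →ₗ[A] X) :=
  fun s _ _ hx => (congrArg (s • ·) hx).trans (smul_zero s)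

theorem isAlmostInjective_iff_smul_ker_eq_bot {f : X →ₗ[A] Y} :
    IsAlmostInjective I f ↔ I • LinearMap.ker f = ⊥ := by
  rw [eq_bot_iff, Submodule.smul_le]
  exact Iff.rfl

theorem isAlmostSurjective_iff_smul_top_eq_bot {f : X →ₗ[A] Y} :
    IsAlmostSurjective I f ↔ I • (⊤ : Submodule A (Y ⧸ LinearMap.range f)) = ⊥ := by
  rw [eq_bot_iff, Submodule.smul_le]
  refine forall₂_congr fun s _ => ?_
  rw [(Submodule.mkQ_surjective (LinearMap.range f)).forall]
  exact forall_congr' fun y => ⟨fun h _ => (Submodule.Quotient.mk_eq_zero _).2 h,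
    fun h => (Submodule.Quotient.mk_eq_zero _).1 (h trivial)⟩

end LinearMap

section Roof

variable [Fact (I * I = I)] {X Y : ModuleCat.{u} A}

theorem monoModSerre_almostZero_iff (f : X ⟶ Y) :
    (almostZero I).monoModSerre f ↔ IsAlmostInjective I f.hom := by
  rw [ObjectProperty.monoModSerre_iff,
    (almostZero I).prop_iff_of_iso (ModuleCat.kernelIsoKer f), almostZero_iff]
  refine forall₂_congr fun s _ => ⟨fun h x hx => ?_, fun h x => Subtype.ext (h x x.2)⟩
  exact congrArg Subtype.val (h ⟨x, hx⟩)

theorem epiModSerre_almostZero_iff (f : X ⟶ Y) :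
    (almostZero I).epiModSerre f ↔ IsAlmostSurjective I f.hom := by
  rw [ObjectProperty.epiModSerre_iff,
    (almostZero I).prop_iff_of_iso (ModuleCat.cokernelIsoRangeQuotient f),
    isAlmostSurjective_iff_smul_top_eq_bot]
  exact Iff.rfl

theorem exists_roof (i : (toAlmost I).obj X ⟶ (toAlmost I).obj Y) :
    ∃ (Z : ModuleCat.{u} A) (σ : Z ⟶ X) (f : Z ⟶ Y),
      (almostZero I).isoModSerre σ ∧ (toAlmost I).map σ ≫ i = (toAlmost I).map f := by
  obtain ⟨φ, rfl⟩ := Localization.exists_rightFraction (toAlmost I) (almostZero I).isoModSerre i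
  exact ⟨φ.X', φ.s, φ.f, φ.hs, φ.map_s_comp_map _ _⟩

theorem exists_roof_of_mono (i : (toAlmost I).obj X ⟶ (toAlmost I).obj Y) [Mono i] :
    ∃ (Z : ModuleCat.{u} A) (σ : Z →ₗ[A] X) (f : Z →ₗ[A] Y),
      IsAlmostInjective I σ ∧ IsAlmostSurjective I σ ∧ IsAlmostInjective I f := by
  obtain ⟨Z, σ, f, hσ, h⟩ := exists_roof i
  have := Localization.inverts (toAlmost I) (almostZero I).isoModSerre σ hσ
  have hf : Mono ((toAlmost I).map f) := h ▸ inferInstance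
  rw [ObjectProperty.SerreClassLocalization.mono_map_iff (toAlmost I) (almostZero I)] at hf
  exact ⟨Z, σ.hom, f.hom, (monoModSerre_almostZero_iff σ).1 hσ.1,
    (epiModSerre_almostZero_iff σ).1 hσ.2, (monoModSerre_almostZero_iff f).1 hf⟩

theorem exists_roof_of_iso (i : (toAlmost I).obj X ≅ (toAlmost I).obj Y) :
    ∃ (Z : ModuleCat.{u} A) (σ : Z →ₗ[A] X) (f : Z →ₗ[A] Y),
      IsAlmostInjective I σ ∧ IsAlmostInjective I f ∧ IsAlmostSurjective I f := by
  obtain ⟨Z, σ, f, hσ, h⟩ := exists_roof i.hom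
  have := Localization.inverts (toAlmost I) (almostZero I).isoModSerre σ hσ
  have hf : IsIso ((toAlmost I).map f) := h ▸ inferInstance
  have hmono : Mono ((toAlmost I).map f) := inferInstance
  have hepi : Epi ((toAlmost I).map f) := inferInstance
  rw [ObjectProperty.SerreClassLocalization.mono_map_iff (toAlmost I) (almostZero I)] at hmono
  rw [ObjectProperty.SerreClassLocalization.epi_map_iff (toAlmost I) (almostZero I)] at hepi
  exact ⟨Z, σ.hom, f.hom, (monoModSerre_almostZero_iff σ).1 hσ.1,
    (monoModSerre_almostZero_iff f).1 hmono, (epiModSerre_almostZero_iff f).1 hepi⟩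

end Roof

section Coherent

variable {c : A}

theorem exists_comp_eq_smul {n : ℕ} {Z X : Type*} [AddCommGroup Z] [Module A Z]
    [AddCommGroup X] [Module A X] {f : Z →ₗ[A] X} (hf : IsAlmostSurjective I f) (hc : c ∈ I)
    (g : (Fin n → A) →ₗ[A] X) : ∃ h : (Fin n → A) →ₗ[A] Z, f ∘ₗ h = c • g := by
  obtain ⟨h, hh⟩ := Module.projective_lifting_property f.rangeRestrict
    ((c • g).codRestrict (LinearMap.range f) fun v => hf c hc (g v)) f.surjective_rangeRestrict
  exact ⟨h, LinearMap.ext fun v => congrArg Subtype.val (LinearMap.congr_fun hh v)⟩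

theorem isCoherentRing_of_isAlmostInjective {X : Type u} [AddCommGroup X] [Module A X]
    (hX : IsCoherentModule A X) {Z : Type*} [AddCommGroup Z] [Module A Z] {σ : Z →ₗ[A] X}
    {f : Z →ₗ[A] A} (hσ : IsAlmostInjective I σ) (hf : IsAlmostInjective I f)
    (hf' : IsAlmostSurjective I f) (hc : c ∈ I) (hreg : IsSMulRegular A c) :
    IsCoherentRing A := by
  refine ⟨inferInstance, fun J hJ => ?_⟩
  obtain ⟨n, g, rfl⟩ := (Submodule.fg_iff_exists_fin_linearMap A A).1 hJ
  obtain ⟨h, hfh⟩ := exists_comp_eq_smul hf' hc g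
  have hfh (v : Fin n → A) : f (h v) = c • g v := LinearMap.congr_fun hfh v
  -- Multiplying by `c` lifts `g` along `f` and absorbs the kernels of `f` and `σ`, so that `k`
  -- embeds the ideal `g(Aⁿ)` in `X`.
  let k : (Fin n → A) →ₗ[A] X := σ ∘ₗ (c • h)
  have hker : LinearMap.ker k = LinearMap.ker g := by
    ext v
    refine ⟨fun hv => ?_, fun hv => ?_⟩
    · have h0 := congrArg f (hσ c hc _ hv)
      rw [LinearMap.smul_apply, map_smul, map_smul, hfh, map_zero] at h0
      exact hreg.right_eq_zero_of_smul (hreg.right_eq_zero_of_smul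
        (hreg.right_eq_zero_of_smul h0))
    · have h0 : f (h v) = 0 := by rw [hfh, LinearMap.mem_ker.1 hv, smul_zero]
      exact (congrArg σ (hf c hc _ h0)).trans (map_zero σ)
  have hrange : Module.FinitePresentation A (LinearMap.range k) := hX.2 _ (Submodule.fg_range k)
  exact .of_equiv (k.quotKerEquivRange.symm ≪≫ₗ Submodule.quotEquivOfEq _ _ hker ≪≫ₗ
    g.quotKerEquivRange)

theorem AlmostIsomorphic.isCoherentRing [Fact (I * I = I)] {X : ModuleCat.{u} A}
    (h : AlmostIsomorphic I X (ModuleCat.of A A)) (hX : IsCoherentModule A X) (hc : c ∈ I)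
    (hreg : IsSMulRegular A c) : IsCoherentRing A := by
  obtain ⟨i⟩ := h
  obtain ⟨Z, σ, f, hσ, hf, hf'⟩ := exists_roof_of_iso i
  exact isCoherentRing_of_isAlmostInjective hX hσ hf hf' hc hreg

end Coherent

section AlmostFinitelyFree

/-- A module `X` is almost finitely free if for every `s ∈ I` there is an injective map `Aⁿ → X`
whose cokernel is killed by `s`. -/
def IsAlmostFinitelyFree (I : Ideal A) (X : Type*) [AddCommGroup X] [Module A X] : Prop :=
  ∀ s ∈ I, ∃ (n : ℕ) (f : (Fin n → A) →ₗ[A] X),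
    Function.Injective f ∧ ∀ x : X, s • x ∈ LinearMap.range f

theorem isAlmostFinitelyFree_of_subsingleton {X : Type*} [AddCommGroup X] [Module A X]
    [Subsingleton X] : IsAlmostFinitelyFree I X :=
  fun _ _ => ⟨0, 0, Function.injective_of_subsingleton _, fun _ => ⟨0, Subsingleton.elim _ _⟩⟩

theorem isAlmostFinitelyFree_ideal [IsDomain A] {J : Ideal A}
    (h : ∀ s ∈ I, ∃ a ∈ J, a ≠ 0 ∧ ∀ y ∈ J, a ∣ s * y) : IsAlmostFinitelyFree I J := by
  intro s hs
  obtain ⟨a, haJ, ha, hdvd⟩ := h s hs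
  refine ⟨1, LinearMap.toSpanSingleton A J ⟨a, haJ⟩ ∘ₗ LinearMap.proj 0, ?_, fun y => ?_⟩
  · refine (injective_iff_map_eq_zero _).2 fun v hv => ?_
    have hva : v 0 * a = 0 := congrArg Subtype.val hv
    exact funext fun j => Subsingleton.elim 0 j ▸ (mul_eq_zero.1 hva).resolve_right ha
  · obtain ⟨t, ht⟩ := hdvd y y.2
    exact ⟨fun _ => t, Subtype.ext ((mul_comm t a).trans ht.symm)⟩

variable {X : Type u} [AddCommGroup X] [Module A X]

theorem IsAlmostFinitelyFree.isAlmostFG (hX : IsAlmostFinitelyFree I X) : IsAlmostFG I X := by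
  intro s hs
  obtain ⟨n, f, -, hf⟩ := hX s hs
  exact ⟨n, f, hf⟩

theorem IsAlmostFinitelyFree.isAlmostFP (hX : IsAlmostFinitelyFree I X) : IsAlmostFP I X := by
  intro s hs t _
  obtain ⟨n, f, hinj, hf⟩ := hX s hs
  refine ⟨n, 0, f, 0, LinearMap.comp_zero f, hf, fun y hy => ⟨0, ?_⟩⟩
  rw [hinj (hy.trans (map_zero f).symm), smul_zero, map_zero]

theorem IsAlmostFinitelyFree.of_range {Z N : Type*} [AddCommGroup Z] [Module A Z]
    [AddCommGroup N] [Module A N] {σ : Z →ₗ[A] N} {f : Z →ₗ[A] X}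
    (h : IsAlmostFinitelyFree I (LinearMap.range f)) (hσ : IsAlmostInjective I σ)
    (hσ' : IsAlmostSurjective I σ) (hf : IsAlmostInjective I f)
    (hI : ∀ s ∈ I, ∃ a ∈ I, ∃ b ∈ I, a * b = s) {c : A} (hc : c ∈ I)
    (hreg : IsSMulRegular A c) : IsAlmostFinitelyFree I N := by
  intro s hs
  obtain ⟨r, hr, s₁, hs₁, rfl⟩ := hI s hs
  obtain ⟨s₂, hs₂, s₃, hs₃, rfl⟩ := hI s₁ hs₁
  obtain ⟨n, φ, hφ, hφ'⟩ := h s₂ hs₂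
  obtain ⟨ψ, hψ⟩ :=
    Module.projective_lifting_property f.rangeRestrict φ f.surjective_rangeRestrict
  have hfψ (v : Fin n → A) : f (ψ v) = φ v := congrArg Subtype.val (LinearMap.congr_fun hψ v)
  refine ⟨n, σ ∘ₗ ψ, (injective_iff_map_eq_zero _).2 fun v hv => ?_, fun x => ?_⟩
  · have hcv : φ (c • v) = 0 := by
      rw [← Submodule.coe_eq_zero, ← hfψ, map_smul, hσ c hc _ hv, map_zero]
    exact (IsSMulRegular.pi fun _ => hreg).right_eq_zero_of_smul ((map_eq_zero_iff φ hφ).1 hcv)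
  · obtain ⟨w, hw⟩ := hσ' s₃ hs₃ x
    obtain ⟨v, hv⟩ := hφ' (f.rangeRestrict w)
    have hdiff : f (ψ v - s₂ • w) = 0 := by
      rw [map_sub, hfψ, hv, map_smul, sub_eq_zero]
      rfl
    have hkill : r • ψ v = r • s₂ • w := by
      rw [← sub_eq_zero, ← smul_sub, hf r hr _ hdiff]
    refine ⟨r • v, ?_⟩
    rw [LinearMap.comp_apply, map_smul, hkill, map_smul, map_smul, hw, mul_smul, mul_smul]

theorem isAlmostCoherent_of_forall_submodule [Fact (I * I = I)]
    (hX : ∀ Y : Submodule A X, IsAlmostFinitelyFree I Y)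
    (hI : ∀ s ∈ I, ∃ a ∈ I, ∃ b ∈ I, a * b = s) {c : A} (hc : c ∈ I)
    (hreg : IsSMulRegular A c) : IsAlmostCoherent I (ModuleCat.of A X) := by
  have hsub (N : ModuleCat.{u} A) (i : (toAlmost I).obj N ⟶ (toAlmost I).obj (.of A X))
      (_ : Mono i) : IsAlmostFinitelyFree I N := by
    obtain ⟨Z, σ, f, hσ, hσ', hf⟩ := exists_roof_of_mono i
    exact .of_range (hX (LinearMap.range f)) hσ hσ' hf hI hc hreg
  exact ⟨(hsub _ (𝟙 _) inferInstance).isAlmostFG, fun N i hi _ => (hsub N i hi).isAlmostFP⟩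

end AlmostFinitelyFree

end

end AlmostMath

/-- Divisibility in `A` is total up to the ideal `I`. For the maximal ideal of a local domain this
is the elementwise form of the pseudo-valuation property: each `x = b / a` in the fraction field
lies in `A` or satisfies `x⁻¹ I ⊆ A`. -/
def IsPseudoDvdTotal {A : Type*} [CommRing A] (I : Ideal A) : Prop :=
  ∀ a b : A, a ∣ b ∨ ∀ m ∈ I, b ∣ a * m

namespace IsPseudoDvdTotal

section

variable {A : Type*} [CommRing A] {I : Ideal A}

section Idempotent

variable (h : IsPseudoDvdTotal I) (hI : I * I = I)
include h hI

theorem span_singleton_mul_le_total (a b : A) :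
    Ideal.span {a} * I ≤ Ideal.span {b} * I ∨ Ideal.span {b} * I ≤ Ideal.span {a} * I := by
  refine (h a b).symm.imp (fun hdvd => ?_) fun hdvd =>
    Ideal.mul_mono_left (Ideal.span_singleton_le_span_singleton.2 hdvd)
  have hle : Ideal.span {a} * I ≤ Ideal.span {b} :=
    Ideal.span_singleton_mul_le_iff.2 fun m hm => Ideal.mem_span_singleton.2 (hdvd m hm)
  calc Ideal.span {a} * I = Ideal.span {a} * I * I := by rw [mul_assoc, hI]
    _ ≤ Ideal.span {b} * I := Ideal.mul_mono_left hle

theorem directed_span_singleton_mul :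
    Directed (· ≤ ·) fun a : I => Ideal.span {(a : A)} * I := fun a b =>
  (h.span_singleton_mul_le_total hI a b).elim (fun hab => ⟨b, hab, le_rfl⟩)
    fun hba => ⟨a, le_rfl, hba⟩

theorem exists_mem_span_singleton_mul {s : A} (hs : s ∈ I) :
    ∃ a : I, s ∈ Ideal.span {(a : A)} * I := by
  rw [← hI] at hs
  induction hs using Submodule.mul_induction_on' with
  | mem_mul_mem a ha b hb => exact ⟨⟨a, ha⟩, Ideal.mul_mem_mul (Ideal.mem_span_singleton_self a) hb⟩
  | add s _ t _ hs ht =>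
    obtain ⟨a, ha⟩ := hs
    obtain ⟨b, hb⟩ := ht
    obtain ⟨c, hac, hbc⟩ := h.directed_span_singleton_mul hI a b
    exact ⟨c, add_mem (hac ha) (hbc hb)⟩

theorem exists_mem_mul_mem_eq {s : A} (hs : s ∈ I) : ∃ a ∈ I, ∃ b ∈ I, a * b = s := by
  obtain ⟨⟨a, ha⟩, hsa⟩ := h.exists_mem_span_singleton_mul hI hs
  exact ⟨a, ha, Ideal.mem_span_singleton_mul.1 hsa⟩

theorem exists_forall_mem_mul_eq {ι : Type*} [Finite ι] (x : ι → I) :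
    ∃ a ∈ I, ∀ i, ∃ b ∈ I, a * b = x i := by
  choose f hf using fun i => h.exists_mem_span_singleton_mul hI (x i).2
  obtain ⟨a, ha⟩ := (h.directed_span_singleton_mul hI).finite_le f
  exact ⟨a, a.2, fun i => Ideal.mem_span_singleton_mul.1 (ha i (hf i))⟩

theorem flat [IsDomain A] : Module.Flat A I := by
  refine Module.Flat.of_forall_isTrivialRelation fun {l f x} hfx => ?_
  obtain ⟨a, ha, hax⟩ := h.exists_forall_mem_mul_eq hI x
  choose b _ hb using hax
  by_cases ha0 : a = 0
  · have hx (i : Fin l) : x i = 0 := Subtype.ext (by rw [← hb, ha0, zero_mul, Submodule.coe_zero])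
    exact ⟨0, nofun, nofun, fun i => hx i, nofun⟩
  refine ⟨1, fun i _ => b i, fun _ => ⟨a, ha⟩, fun i => Subtype.ext ?_, fun _ => ?_⟩
  · simp [← hb, mul_comm]
  · have hsum : ∑ i, f i * (x i : A) = 0 := by simpa using congrArg Subtype.val hfx
    refine (mul_eq_zero.1 ?_).resolve_left ha0
    rw [← hsum, Finset.mul_sum]
    exact Finset.sum_congr rfl fun i _ => by rw [← hb, mul_left_comm]

theorem exists_mem_forall_dvd_mul [IsDomain A] (htop : I ≠ ⊤)
    (hrad : ∀ a : A, a ≠ 0 → I ≤ (Ideal.span {a}).radical) {J : Ideal A} (hJ : J ≠ ⊥) {s : A}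
    (hs : s ∈ I) : ∃ a ∈ J, a ≠ 0 ∧ ∀ y ∈ J, a ∣ s * y := by
  obtain ⟨t, ht, u, hu, rfl⟩ := h.exists_mem_mul_mem_eq hI hs
  obtain ⟨c, hcJ, hc⟩ := J.ne_bot_iff.1 hJ
  by_contra! hcon
  have hdescent (n : ℕ) : ∃ a ∈ J, t ^ n * a ∣ c := by
    induction n with
    | zero => exact ⟨c, hcJ, by simp⟩
    | succ n ih =>
      obtain ⟨a, haJ, hac⟩ := ih
      obtain ⟨y, hyJ, hy⟩ := hcon a haJ (right_ne_zero_of_mul (ne_zero_of_dvd_ne_zero hc hac))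
      have hta : t * y ∣ a := (h (t * y) a).resolve_right fun hm =>
        hy (mul_right_comm t u y ▸ hm u hu)
      exact ⟨y, hyJ, dvd_trans (by rw [pow_succ, mul_assoc]; exact mul_dvd_mul_left _ hta) hac⟩
  obtain ⟨n, hn⟩ := hrad c hc ht
  obtain ⟨a, -, ha⟩ := hdescent (n + 1)
  have htc : c * t ∣ c * 1 := by
    rw [mul_one]
    refine dvd_trans ?_ ((dvd_mul_right _ a).trans ha)
    exact pow_succ t n ▸ mul_dvd_mul_right (Ideal.mem_span_singleton.1 hn) t
  exact htop (I.eq_top_of_isUnit_mem ht (isUnit_of_dvd_one ((mul_dvd_mul_iff_left hc).1 htc)))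

end Idempotent

theorem colon_singleton_eq (h : IsPseudoDvdTotal I) (hI : I.IsMaximal) {a b : A} (hab : ¬ a ∣ b)
    (hba : ¬ b ∣ a) : (Ideal.span {a}).colon {b} = I := by
  refine (hI.eq_of_le (fun htop => hab ?_) fun m hm => ?_).symm
  · have hone : (1 : A) ∈ (Ideal.span {a}).colon {b} := htop ▸ Submodule.mem_top
    rwa [Submodule.mem_colon_singleton, one_smul, Ideal.mem_span_singleton] at hone
  · rw [Submodule.mem_colon_singleton, Ideal.mem_span_singleton, smul_eq_mul, mul_comm]
    exact (h b a).resolve_left hba m hm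

end

theorem not_isCoherentRing {A : Type u} [CommRing A] {I : Ideal A} (h : IsPseudoDvdTotal I)
    (hI : I.IsMaximal) (hfg : ¬ I.FG) {a b : A} (hab : ¬ a ∣ b) (hba : ¬ b ∣ a) :
    ¬ IsCoherentRing A := fun hA =>
  hfg (h.colon_singleton_eq hI hab hba ▸
    hA.fg_colon_singleton (Submodule.fg_span_singleton a) b)

section PseudoValuationDomain

variable {A : Type u} [CommRing A] [IsDomain A] [IsLocalRing A]

open IsLocalRing

theorem forall_exists_algebraMap_eq_mul (h : IsPseudoDvdTotal (maximalIdeal A)) {x : FractionRing A}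
    (hx : x ∉ Set.range (algebraMap A (FractionRing A))) :
    ∀ m ∈ maximalIdeal A, ∃ n ∈ maximalIdeal A,
      algebraMap A (FractionRing A) m = x * algebraMap A (FractionRing A) n := by
  intro m hm
  obtain ⟨a, b, hb, rfl⟩ := IsFractionRing.div_surjective (A := A) x
  have hb0 := IsFractionRing.to_map_ne_zero_of_mem_nonZeroDivisors (K := FractionRing A) hb
  have hba : ¬ b ∣ a := by
    rintro ⟨c, rfl⟩
    exact hx ⟨c, by rw [map_mul, mul_div_cancel_left₀ _ hb0]⟩
  obtain ⟨n, hn⟩ := (h b a).resolve_left hba m hm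
  refine ⟨n, fun hunit => hba (hunit.dvd_mul_right.1 (hn ▸ dvd_mul_right b m)), ?_⟩
  rw [div_mul_eq_mul_div, ← map_mul, ← hn, map_mul, mul_div_cancel_left₀ _ hb0]

theorem mem_image_algebraMap_of_mul_mem (h : IsPseudoDvdTotal (maximalIdeal A)) {P : Ideal A}
    (hP : P.IsPrime) {x y : FractionRing A} (hx : x ∉ Set.range (algebraMap A (FractionRing A)))
    (hxy : x * y ∈ algebraMap A (FractionRing A) '' (P : Set A)) :
    y ∈ algebraMap A (FractionRing A) '' (P : Set A) := by
  have hx0 : x ≠ 0 := fun h0 => hx ⟨0, (map_zero _).trans h0.symm⟩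
  obtain ⟨p, hp, hpxy⟩ := hxy
  obtain ⟨n, hn, hpn⟩ := h.forall_exists_algebraMap_eq_mul hx p (le_maximalIdeal hP.ne_top hp)
  obtain ⟨k, -, hnk⟩ := h.forall_exists_algebraMap_eq_mul hx n hn
  have hsq : n * n = p * k := by
    apply IsFractionRing.injective A (FractionRing A)
    rw [map_mul, map_mul, hpn, mul_right_comm, ← hnk]
  have hnP : n ∈ P := (hP.mem_or_mem (hsq ▸ P.mul_mem_right k hp)).elim id id
  exact ⟨n, hnP, mul_left_cancel₀ hx0 (hpn.symm.trans hpxy)⟩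

theorem isPseudoValuationDomain (h : IsPseudoDvdTotal (maximalIdeal A)) :
    IsPseudoValuationDomain A := by
  intro P hP x y hxy
  by_cases hx : x ∈ Set.range (algebraMap A (FractionRing A))
  · by_cases hy : y ∈ Set.range (algebraMap A (FractionRing A))
    · obtain ⟨a, rfl⟩ := hx
      obtain ⟨b, rfl⟩ := hy
      rw [← map_mul, (IsFractionRing.injective A _).mem_set_image] at hxy
      exact (hP.mem_or_mem hxy).imp (Set.mem_image_of_mem _) (Set.mem_image_of_mem _)
    · exact .inl (h.mem_image_algebraMap_of_mul_mem hP hy (mul_comm x y ▸ hxy))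
  · exact .inr (h.mem_image_algebraMap_of_mul_mem hP hx hxy)

end PseudoValuationDomain

theorem comap_subtype_maximalIdeal {V : Type*} [CommRing V] [IsDomain V] [ValuationRing V]
    {S : Subring V} (hS : (IsLocalRing.maximalIdeal V : Set V) ⊆ S) :
    IsPseudoDvdTotal ((IsLocalRing.maximalIdeal V).comap S.subtype) := by
  intro a b
  rw [or_iff_not_imp_left]
  intro hab m hm
  suffices hba : (b : V) ∣ a by
    obtain ⟨v, hv⟩ := hba
    refine ⟨⟨v * m, hS (Ideal.mul_mem_left _ v hm)⟩, Subtype.ext ?_⟩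
    simp [hv, mul_assoc]
  by_contra hba
  obtain ⟨v, hv⟩ := (ValuationRing.dvd_total (a : V) b).resolve_right hba
  by_cases hunit : IsUnit v
  · exact hba (hv ▸ hunit.mul_right_dvd.2 dvd_rfl)
  · exact hab ⟨⟨v, hS hunit⟩, Subtype.ext hv⟩

end IsPseudoDvdTotal

theorem comap_subtype_le_radical_span_singleton {V : Type*} [CommRing V] {S : Subring V}
    {J : Ideal V} (hJ : (J : Set V) ⊆ S) {a : S} (ha : J ≤ (Ideal.span {(a : V)}).radical) :
    J.comap S.subtype ≤ (Ideal.span {a}).radical := by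
  intro m hm
  obtain ⟨n, hn⟩ := ha hm
  obtain ⟨v, hv⟩ := Ideal.mem_span_singleton.1 hn
  refine ⟨n + 1, Ideal.mem_span_singleton.2 ⟨⟨v * m, hJ (J.mul_mem_left v hm)⟩, Subtype.ext ?_⟩⟩
  simpa [pow_succ, mul_assoc] using congrArg (· * (m : V)) hv

theorem eq_of_isPrime_of_le_radical {A : Type*} [CommRing A] {I P : Ideal A} (hI : I.IsMaximal)
    (hrad : ∀ a : A, a ≠ 0 → I ≤ (Ideal.span {a}).radical) (hP : P.IsPrime) (hP0 : P ≠ ⊥) :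
    P = I := by
  obtain ⟨a, haP, ha⟩ := P.ne_bot_iff.1 hP0
  refine (hI.eq_of_le hP.ne_top ((hrad a ha).trans ?_)).symm
  exact hP.radical_le_iff.2 ((Ideal.span_singleton_le_iff_mem P).2 haP)

theorem exists_valuation_integers {V Γ₀ : Type*} [CommRing V] [IsDomain V]
    [LinearOrderedCommGroupWithZero Γ₀] (w : Valuation V Γ₀) (hw : ∀ a b, w a ≤ w b ↔ b ∣ a)
    (K : Type*) [Field K] [Algebra V K] [IsFractionRing V K] :
    ∃ v : Valuation K Γ₀, v.Integers V ∧ ∀ a, v (algebraMap V K a) = w a := by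
  have hw0 (a : V) : w a = 0 ↔ a = 0 := by
    rw [← zero_dvd_iff (a := a), ← hw, map_zero, le_zero_iff]
  have hsupp : nonZeroDivisors V ≤ w.supp.primeCompl := fun a ha h =>
    nonZeroDivisors.ne_zero ha ((hw0 a).1 h)
  have hv := w.extendToLocalization_apply_map_apply hsupp K
  refine ⟨w.extendToLocalization hsupp K, ⟨IsFractionRing.injective V K, fun a => ?_,
    fun k hk => ?_⟩, hv⟩
  · rw [hv, ← map_one w, hw]
    exact one_dvd a
  · obtain ⟨a, b, hb, rfl⟩ := IsFractionRing.div_surjective (A := V) k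
    have hb0 := nonZeroDivisors.ne_zero hb
    rw [map_div₀, hv, hv, div_le_one₀ (zero_lt_iff.2 ((hw0 b).not.2 hb0)), hw] at hk
    obtain ⟨c, rfl⟩ := hk
    exact ⟨c, by rw [map_mul, mul_div_cancel_left₀ _
      (IsFractionRing.to_map_ne_zero_of_mem_nonZeroDivisors hb)]⟩

/-- A multiplicative family of nonzero elements of `V`, none of them a unit except the trivial one,
such that every nonzero element of `V` is associated to one of them. The exponents are written
multiplicatively; for `V = D_Q` they are those of the powers of the variable. -/
structure IsMonomialSystem {G V : Type*} [Monoid G] [CommRing V] (x : G →* V) : Prop where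
  ne_zero : ∀ γ, x γ ≠ 0
  eq_one_of_isUnit : ∀ γ, IsUnit (x γ) → γ = 1
  exists_associated : ∀ a : V, a ≠ 0 → ∃ γ, Associated (x γ) a

namespace IsMonomialSystem

section Ord

variable {G V : Type*} [Monoid G] [CommRing V] {x : G →* V}

open Classical in
/-- The exponent of the monomial associated to an element of `V`, with the junk value `1` at
`0`. -/
noncomputable def ord (hx : IsMonomialSystem x) (a : V) : G :=
  if ha : a = 0 then 1 else (hx.exists_associated a ha).choose

theorem associated_ord (hx : IsMonomialSystem x) {a : V} (ha : a ≠ 0) :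
    Associated (x (hx.ord a)) a := by
  rw [ord, dif_neg ha]
  exact (hx.exists_associated a ha).choose_spec

end Ord

variable {G V : Type*} [CommMonoid G] [LinearOrder G] [CanonicallyOrderedMul G] [CommRing V]
  [IsDomain V] {x : G →* V}

theorem dvd_iff_le (hx : IsMonomialSystem x) {p q : G} : x p ∣ x q ↔ p ≤ q := by
  refine ⟨fun h => ?_, fun h => ?_⟩
  · by_contra! hlt
    obtain ⟨r, rfl⟩ := exists_mul_of_le hlt.le
    have hr : IsUnit (x r) := by
      rw [map_mul] at h
      exact isUnit_of_dvd_one ((mul_dvd_mul_iff_left (hx.ne_zero q)).1 (by rwa [mul_one]))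
    exact hlt.ne (by rw [hx.eq_one_of_isUnit r hr, mul_one])
  · obtain ⟨r, rfl⟩ := exists_mul_of_le h
    exact map_mul x p r ▸ dvd_mul_right _ _

theorem valuationRing (hx : IsMonomialSystem x) : ValuationRing V := by
  rw [ValuationRing.iff_dvd_total]
  refine ⟨fun a b => ?_⟩
  by_cases ha : a = 0
  · exact .inr (ha ▸ dvd_zero b)
  by_cases hb : b = 0
  · exact .inl (hb ▸ dvd_zero a)
  obtain ⟨p, hp⟩ := hx.exists_associated a ha
  obtain ⟨q, hq⟩ := hx.exists_associated b hb
  rw [← hp.dvd_iff_dvd_left, ← hq.dvd_iff_dvd_right, ← hq.dvd_iff_dvd_left,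
    ← hp.dvd_iff_dvd_right, hx.dvd_iff_le, hx.dvd_iff_le]
  exact le_total p q

theorem exists_dvd_pow [MulArchimedean G] (hx : IsMonomialSystem x) {a m : V} (ha : a ≠ 0)
    (hm : ¬ IsUnit m) : ∃ n : ℕ, a ∣ m ^ n := by
  by_cases hm0 : m = 0
  · exact ⟨1, by simp [hm0]⟩
  obtain ⟨p, hp⟩ := hx.exists_associated a ha
  obtain ⟨q, hq⟩ := hx.exists_associated m hm0
  have hq1 : 1 < q := one_lt_iff_ne_one.2 fun h => hm (hq.isUnit (by simp [h]))
  obtain ⟨n, hn⟩ := MulArchimedean.arch p hq1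
  exact ⟨n, hp.symm.dvd.trans ((hx.dvd_iff_le.2 hn).trans (map_pow x q n ▸ (hq.pow_pow).dvd))⟩

section

variable (hx : IsMonomialSystem x) {a b : V}
include hx

theorem ord_eq_of_associated {γ : G} (h : Associated (x γ) a) : hx.ord a = γ := by
  have h' := (hx.associated_ord (h.ne_zero_iff.1 (hx.ne_zero γ))).trans h.symm
  exact le_antisymm (hx.dvd_iff_le.1 h'.dvd) (hx.dvd_iff_le.1 h'.symm.dvd)

theorem ord_apply (γ : G) : hx.ord (x γ) = γ := hx.ord_eq_of_associated (.refl _)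

theorem ord_le_ord_iff_dvd (ha : a ≠ 0) (hb : b ≠ 0) : hx.ord a ≤ hx.ord b ↔ a ∣ b := by
  rw [← hx.dvd_iff_le, (hx.associated_ord ha).dvd_iff_dvd_left,
    (hx.associated_ord hb).dvd_iff_dvd_right]

theorem ord_mul (ha : a ≠ 0) (hb : b ≠ 0) : hx.ord (a * b) = hx.ord a * hx.ord b := by
  apply hx.ord_eq_of_associated
  rw [map_mul]
  exact (hx.associated_ord ha).mul_mul (hx.associated_ord hb)

end

section Valuation

variable {H : Type*} [CommGroup H] [LinearOrder H] [IsOrderedMonoid H] {ι : G →* H}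

theorem exists_valuation (hx : IsMonomialSystem x) (hι : StrictMono ι) :
    ∃ w : Valuation V (WithZero H), (∀ a b, w a ≤ w b ↔ b ∣ a) ∧ ∀ γ, w (x γ) = ↑(ι γ)⁻¹ := by
  classical
  let w (a : V) : WithZero H := if a = 0 then 0 else ↑(ι (hx.ord a))⁻¹
  have hw (a b : V) : w a ≤ w b ↔ b ∣ a := by
    by_cases ha : a = 0
    · simp [w, ha]
    by_cases hb : b = 0
    · simp [w, ha, hb]
    simp only [w, if_neg ha, if_neg hb, WithZero.coe_le_coe, inv_le_inv_iff, hι.le_iff_le,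
      hx.ord_le_ord_iff_dvd hb ha]
  have hxw (γ : G) : w (x γ) = ↑(ι γ)⁻¹ := by simp only [w, if_neg (hx.ne_zero γ), hx.ord_apply]
  have hw1 : w 1 = 1 := by rw [← map_one x, hxw, map_one, inv_one, WithZero.coe_one]
  have hwmul (a b : V) : w (a * b) = w a * w b := by
    by_cases ha : a = 0
    · simp [w, ha]
    by_cases hb : b = 0
    · simp [w, hb]
    simp only [w, if_neg ha, if_neg hb, if_neg (mul_ne_zero ha hb), hx.ord_mul ha hb, map_mul,
      mul_inv, WithZero.coe_mul]
  have hwadd (a b : V) : w (a + b) ≤ max (w a) (w b) := by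
    have := hx.valuationRing
    rw [le_max_iff, hw, hw]
    exact (ValuationRing.dvd_total a b).imp (dvd_add dvd_rfl) (dvd_add · dvd_rfl)
  exact ⟨⟨⟨⟨w, if_pos rfl⟩, hw1, hwmul⟩, hwadd⟩, hw, hxw⟩

theorem exists_surjective_valuation_integers (hx : IsMonomialSystem x) (hι : StrictMono ι)
    (hdiv : ∀ h, ∃ p q, h = ι p / ι q) (K : Type*) [Field K] [Algebra V K] [IsFractionRing V K] :
    ∃ v : Valuation K (WithZero H), Function.Surjective v ∧ v.Integers V := by
  obtain ⟨w, hw, hxw⟩ := hx.exists_valuation hι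
  obtain ⟨v, hv, hvw⟩ := exists_valuation_integers w hw K
  refine ⟨v, fun γ => ?_, hv⟩
  induction γ with
  | zero => exact ⟨0, map_zero v⟩
  | coe h =>
    obtain ⟨p, q, rfl⟩ := hdiv h
    refine ⟨algebraMap V K (x q) / algebraMap V K (x p), ?_⟩
    rw [map_div₀, hvw, hvw, hxw, hxw, ← WithZero.coe_div, inv_div_inv]

end Valuation

end IsMonomialSystem

theorem single_divOf_mul_eq_self {k G : Type*} [Semiring k] [AddCommMonoid G] [IsCancelAdd G]
    {d : AddMonoidAlgebra k G} {g : G} (hg : ∀ p ∈ d.coeff.support, ∃ r, p = g + r) :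
    AddMonoidAlgebra.single g 1 * d.divOf g = d := by
  have hmod : d.modOf g = 0 := by
    ext p
    by_cases hp : ∃ r, p = g + r
    · rw [AddMonoidAlgebra.coeff_modOf_of_exists_add _ _ _ hp, AddMonoidAlgebra.coeff_zero,
        Finsupp.zero_apply]
    · rw [AddMonoidAlgebra.coeff_modOf_of_not_exists_add _ _ _ hp]
      exact Finsupp.notMem_support_iff.1 fun h => hp (hg p h)
  have h := AddMonoidAlgebra.divOf_add_modOf d g
  rwa [hmod, add_zero] at h

theorem exists_eq_single_mul {k G : Type*} [Semiring k] [AddCommMonoid G] [IsCancelAdd G]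
    [LinearOrder G] [CanonicallyOrderedAdd G] {d : AddMonoidAlgebra k G} (hd : d ≠ 0) :
    ∃ (g : G) (e : AddMonoidAlgebra k G),
      e.coeff 0 ≠ 0 ∧ d = AddMonoidAlgebra.single g 1 * e := by
  have hsupp : d.coeff.support.Nonempty := by
    rwa [Finsupp.support_nonempty_iff, ne_eq, AddMonoidAlgebra.coeff_eq_zero]
  obtain ⟨g, hg, hmin⟩ := d.coeff.support.exists_min_image id hsupp
  refine ⟨g, d.divOf g, ?_, (single_divOf_mul_eq_self fun p hp =>
    exists_add_of_le (hmin p hp)).symm⟩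
  rw [AddMonoidAlgebra.coeff_divOf, add_zero]
  exact Finsupp.mem_support_iff.1 hg

namespace PVDExample

noncomputable section

theorem constCoeff_eq_coeff (d : D) : constCoeff d = d.coeff 0 := by
  induction d using AddMonoidAlgebra.induction_linear with
  | zero => simp
  | add a b ha hb => simp [ha, hb]
  | single q r => by_cases hq : q = 0 <;> simp [constCoeff, hq]

/-- The powers `x^q` of the variable, as elements of `V`. -/
def xpow : Multiplicative ℚ≥0 →* V :=
  (algebraMap D V : D →* V).comp (AddMonoidAlgebra.of ℝ ℚ≥0)

theorem xpow_mem {γ : Multiplicative ℚ≥0} (hγ : γ ≠ 1) : xpow γ ∈ M := by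
  have hM : M = Q.map (algebraMap D V) := Localization.AtPrime.map_eq_maximalIdeal.symm
  rw [hM]
  exact Ideal.mem_map_of_mem _ (single_mem hγ 1)

theorem xpow_ne_zero (γ : Multiplicative ℚ≥0) : xpow γ ≠ 0 :=
  (FaithfulSMul.algebraMap_eq_zero_iff D V).not.2
    (AddMonoidAlgebra.single_eq_zero.not.2 one_ne_zero)

theorem exists_associated_xpow {v : V} (hv : v ≠ 0) : ∃ γ, Associated (xpow γ) v := by
  obtain ⟨d, s, rfl⟩ := IsLocalization.exists_mk'_eq Q.primeCompl v
  have hd : d ≠ 0 := by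
    rintro rfl
    exact hv (IsLocalization.mk'_zero _)
  obtain ⟨q, e, he, rfl⟩ := exists_eq_single_mul hd
  have hunit : IsUnit (IsLocalization.mk' V e s) := by
    rwa [← IsLocalRing.notMem_maximalIdeal, IsLocalization.AtPrime.mk'_mem_maximal_iff V Q,
      Q_eq_ker, RingHom.mem_ker, constCoeff_eq_coeff]
  refine ⟨.ofAdd q, hunit.unit, ?_⟩
  exact IsLocalization.mul_mk'_eq_mk'_of_mul (S := V) _ e s

theorem isMonomialSystem_xpow : IsMonomialSystem xpow where
  ne_zero := xpow_ne_zero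
  eq_one_of_isUnit γ h := by
    by_contra hγ
    exact IsLocalRing.notMem_maximalIdeal.2 h (xpow_mem hγ)
  exists_associated _ := exists_associated_xpow

instance valuationRing_V : ValuationRing V := isMonomialSystem_xpow.valuationRing

theorem exists_dvd_pow_of_mem_M {a m : V} (ha : a ≠ 0) (hm : m ∈ M) : ∃ n : ℕ, a ∣ m ^ n := by
  have : MulArchimedean (Multiplicative ℚ≥0) := ⟨fun p _ hq => Archimedean.arch p.toAdd hq⟩
  exact isMonomialSystem_xpow.exists_dvd_pow ha ((IsLocalRing.mem_maximalIdeal m).1 hm)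

theorem algebra_fractionRing_eq :
    (instAlgebraAtPrimeFractionRing V : Algebra V (FractionRing V)) =
      OreLocalization.instAlgebra := by
  refine Algebra.algebra_ext _ _ fun v => ?_
  refine DFunLike.congr_fun (f := (instAlgebraAtPrimeFractionRing V).algebraMap)
    (g := (OreLocalization.instAlgebra : Algebra V (FractionRing V)).algebraMap)
    (IsLocalization.ringHom_ext Q.primeCompl ?_) v
  refine RingHom.ext fun d => ?_
  exact IsLocalization.lift_eq (M := Q.primeCompl) (S := V) _ d

-- Instance search finds the `V`-algebra structure that `FractionRing V` carries because `V` is a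
-- localization of `D`; the library proves this instance for the structure of `FractionRing`.
instance isFractionRing_fractionRing : IsFractionRing V (FractionRing V) := by
  rw [IsFractionRing, algebra_fractionRing_eq]
  exact Localization.isLocalization

theorem exists_surjective_valuation_integers :
    ∃ v : Valuation (FractionRing V) (WithZero (Multiplicative ℚ)),
      Function.Surjective v ∧ v.Integers V := by
  refine isMonomialSystem_xpow.exists_surjective_valuation_integers
    (ι := AddMonoidHom.toMultiplicative (NNRat.coeHom : ℚ≥0 →+ ℚ))
    (fun p q h => NNRat.cast_strictMono (K := ℚ) h) (fun h => ?_) _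
  refine ⟨.ofAdd h.toAdd.toNNRat, .ofAdd (-h.toAdd).toNNRat, ?_⟩
  exact (congrArg Multiplicative.ofAdd (max_zero_sub_max_neg_zero_eq_self h.toAdd)).symm

theorem algebraMap_mem_M_iff {r : ℝ} : algebraMap ℝ V r ∈ M ↔ r = 0 := by
  rw [IsLocalRing.mem_maximalIdeal, mem_nonunits_iff, isUnit_map_iff, isUnit_iff_ne_zero, not_not]

theorem algebraMap_mem_ratAddM_iff {r : ℝ} :
    algebraMap ℝ V r ∈ ratAddM ↔ r ∈ Set.range ((↑) : ℚ → ℝ) := by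
  refine ⟨fun ⟨q, m, hm, h⟩ => ⟨q, ?_⟩, ?_⟩
  · have hr : algebraMap ℝ V (r - q) ∈ M := by
      rwa [map_sub, h, add_sub_cancel_left]
    exact (sub_eq_zero.1 (algebraMap_mem_M_iff.1 hr)).symm
  · rintro ⟨q, rfl⟩
    exact ⟨q, 0, zero_mem M, (add_zero _).symm⟩

instance isLocalHom_subtype_ratAddM : IsLocalHom ratAddM.subtype := by
  refine ⟨?_⟩
  rintro ⟨_, q, m, hm, rfl⟩ h
  have hq : (q : ℝ) ≠ 0 := by
    intro hq
    exact IsLocalRing.notMem_maximalIdeal.2 h (by simpa [hq] using hm)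
  obtain ⟨u, hu⟩ := h.exists_right_inv
  have hqinv : algebraMap ℝ V ((q⁻¹ : ℚ) : ℝ) * algebraMap ℝ V (q : ℝ) = 1 := by
    rw [← map_mul, Rat.cast_inv, inv_mul_cancel₀ hq, map_one]
  have huR : u ∈ ratAddM := by
    refine ⟨q⁻¹, -(algebraMap ℝ V ((q⁻¹ : ℚ) : ℝ) * u * m), neg_mem (M.mul_mem_left _ hm), ?_⟩
    rw [Subring.coe_subtype] at hu
    linear_combination algebraMap ℝ V ((q⁻¹ : ℚ) : ℝ) * hu - u * hqinv
  exact .of_mul_eq_one ⟨u, huR⟩ (Subtype.ext hu)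

instance isLocalRing_R : IsLocalRing R := ratAddM.subtype.domain_isLocalRing

theorem maximalIdeal_R : IsLocalRing.maximalIdeal R = 𝔪 :=
  (IsLocalRing.maximalIdeal_comap ratAddM.subtype).symm

theorem isMaximal_𝔪 : 𝔪.IsMaximal := maximalIdeal_R ▸ IsLocalRing.maximalIdeal.isMaximal R

theorem exists_mem_𝔪_ne_zero : ∃ c ∈ 𝔪, c ≠ 0 := by
  have hx : xpow (.ofAdd 1) ∈ M := xpow_mem (by simp)
  exact ⟨⟨_, mem_ratAddM hx⟩, hx, fun h => xpow_ne_zero _ (congrArg Subtype.val h)⟩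

theorem 𝔪_le_radical_span_singleton {a : R} (ha : a ≠ 0) : 𝔪 ≤ (Ideal.span {a}).radical := by
  refine comap_subtype_le_radical_span_singleton (fun _ => mem_ratAddM) fun m hm => ?_
  obtain ⟨n, hn⟩ := exists_dvd_pow_of_mem_M (fun h => ha (Subtype.ext h)) hm
  exact ⟨n, Ideal.mem_span_singleton.2 hn⟩

theorem 𝔪_ne_bot : 𝔪 ≠ ⊥ := by
  obtain ⟨c, hc, hc0⟩ := exists_mem_𝔪_ne_zero
  exact fun h => hc0 (by rwa [h] at hc)

theorem ringKrullDim_R : ringKrullDim R = 1 := by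
  rw [ringKrullDim_eq_one_iff_of_isLocalRing_isDomain, IsLocalRing.isField_iff_maximalIdeal_eq,
    maximalIdeal_R]
  exact ⟨𝔪_ne_bot, fun _ => 𝔪_le_radical_span_singleton⟩

theorem isPseudoDvdTotal_𝔪 : IsPseudoDvdTotal 𝔪 :=
  .comap_subtype_maximalIdeal fun _ => mem_ratAddM

theorem isPseudoValuationDomain_R : IsPseudoValuationDomain R :=
  IsPseudoDvdTotal.isPseudoValuationDomain (maximalIdeal_R ▸ isPseudoDvdTotal_𝔪)

instance flat_𝔪 : Module.Flat R 𝔪 := isPseudoDvdTotal_𝔪.flat 𝔪_idempotent.out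

theorem not_fg_𝔪 : ¬ 𝔪.FG := fun hfg =>
  ((Ideal.isIdempotentElem_iff_eq_bot_or_top 𝔪 hfg).1 𝔪_idempotent.out).elim 𝔪_ne_bot
    isMaximal_𝔪.ne_top

theorem exists_not_dvd_not_dvd : ∃ a b : R, ¬ a ∣ b ∧ ¬ b ∣ a := by
  have hx : xpow (.ofAdd 1) ∈ M := xpow_mem (by simp)
  have hnd {r s : ℝ} (hs : s ≠ 0) (hrs : Irrational (r / s)) :
      ¬ (⟨_, mem_ratAddM (M.mul_mem_left (algebraMap ℝ V s) hx)⟩ : R) ∣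
        ⟨_, mem_ratAddM (M.mul_mem_left (algebraMap ℝ V r) hx)⟩ := by
    rintro ⟨c, hc⟩
    have hV : algebraMap ℝ V r * xpow (.ofAdd 1) = algebraMap ℝ V s * xpow (.ofAdd 1) * c :=
      congrArg Subtype.val hc
    have hcr : algebraMap ℝ V (r / s) = c := by
      have hs' : algebraMap ℝ V s ≠ 0 := (map_ne_zero_iff _ (algebraMap ℝ V).injective).2 hs
      refine mul_left_cancel₀ (mul_ne_zero hs' (xpow_ne_zero (.ofAdd 1))) ?_
      rw [← hV, mul_right_comm, ← map_mul, mul_div_cancel₀ _ hs]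
    exact hrs (algebraMap_mem_ratAddM_iff.1 (hcr ▸ c.2))
  -- The witnesses are `x` and `√2 x`, each an irrational multiple of the other.
  exact ⟨_, _, hnd one_ne_zero (by rw [div_one]; exact irrational_sqrt_two),
    hnd (by simp) (by rw [one_div]; exact irrational_sqrt_two.inv)⟩

theorem not_isCoherentRing_R : ¬ IsCoherentRing R := by
  obtain ⟨a, b, hab, hba⟩ := exists_not_dvd_not_dvd
  exact isPseudoDvdTotal_𝔪.not_isCoherentRing isMaximal_𝔪 not_fg_𝔪 hab hba

theorem isAlmostFinitelyFree_ideal (J : Ideal R) : AlmostMath.IsAlmostFinitelyFree 𝔪 J := by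
  by_cases hJ : J = ⊥
  · subst hJ
    exact AlmostMath.isAlmostFinitelyFree_of_subsingleton
  · exact AlmostMath.isAlmostFinitelyFree_ideal fun s hs =>
      isPseudoDvdTotal_𝔪.exists_mem_forall_dvd_mul 𝔪_idempotent.out isMaximal_𝔪.ne_top
        (fun _ => 𝔪_le_radical_span_singleton) hJ hs

theorem isAlmostCoherent_R : AlmostMath.IsAlmostCoherent 𝔪 (ModuleCat.of R R) := by
  obtain ⟨c, hc, hc0⟩ := exists_mem_𝔪_ne_zero
  exact AlmostMath.isAlmostCoherent_of_forall_submodule isAlmostFinitelyFree_ideal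
    (fun _ => isPseudoDvdTotal_𝔪.exists_mem_mul_mem_eq 𝔪_idempotent.out) hc (.of_ne_zero hc0)

theorem not_almostIsomorphic_of_isCoherentModule (P : ModuleCat.{0} R)
    (hP : IsCoherentModule R P) : ¬ AlmostMath.AlmostIsomorphic 𝔪 P (ModuleCat.of R R) := by
  obtain ⟨c, hc, hc0⟩ := exists_mem_𝔪_ne_zero
  exact fun h => not_isCoherentRing_R (h.isCoherentRing hP hc (.of_ne_zero hc0))

theorem not_forall_exists_coherent_approximation :
    ¬ (∀ 𝔪₀ : Ideal R, 𝔪₀ ≤ 𝔪 → 𝔪₀.FG →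
      ∃ (N : ModuleCat.{0} R) (f : N →ₗ[R] R),
        IsCoherentModule R N ∧
        𝔪₀ • LinearMap.ker f = ⊥ ∧
        𝔪₀ • (⊤ : Submodule R (R ⧸ LinearMap.range f)) = ⊥) := by
  obtain ⟨c, hc, hc0⟩ := exists_mem_𝔪_ne_zero
  intro h
  obtain ⟨N, f, hN, hker, hcoker⟩ := h (Ideal.span {c})
    ((Ideal.span_singleton_le_iff_mem 𝔪).2 hc) (Submodule.fg_span_singleton c)
  exact not_isCoherentRing_R (AlmostMath.isCoherentRing_of_isAlmostInjective hN
    AlmostMath.isAlmostInjective_id (AlmostMath.isAlmostInjective_iff_smul_ker_eq_bot.2 hker)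
    (AlmostMath.isAlmostSurjective_iff_smul_top_eq_bot.2 hcoker) (Ideal.mem_span_singleton_self c)
    (.of_ne_zero hc0))

end

end PVDExample

theorem mainTheorem4 :
    -- the ring `V = D_Q` and its maximal ideal `M`
    PVDExample.Q.IsMaximal ∧
    ValuationRing PVDExample.V ∧
    (∃ v : Valuation (FractionRing PVDExample.V) (WithZero (Multiplicative ℚ)),
      Function.Surjective v ∧ v.Integers PVDExample.V) ∧
    -- the ring `R = ℚ + M` and its ideal `𝔪 = M`
    IsPseudoValuationDomain PVDExample.R ∧
    IsLocalRing PVDExample.R ∧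
    PVDExample.𝔪.IsMaximal ∧
    (∀ P : Ideal PVDExample.R, P.IsPrime → P ≠ ⊥ → P = PVDExample.𝔪) ∧
    ringKrullDim PVDExample.R = 1 ∧
    ¬ IsCoherentRing PVDExample.R ∧
    ¬ PVDExample.𝔪.FG ∧
    PVDExample.𝔪 * PVDExample.𝔪 = PVDExample.𝔪 ∧
    Module.Flat PVDExample.R PVDExample.𝔪 ∧
    Module.Flat PVDExample.R (PVDExample.𝔪 ⊗[PVDExample.R] PVDExample.𝔪) ∧
    -- `R` is almost Noetherian and almost coherent
    AlmostMath.IsAlmostNoetherianRing PVDExample.𝔪 ∧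
    AlmostMath.IsAlmostCoherent PVDExample.𝔪 (ModuleCat.of PVDExample.R PVDExample.R) ∧
    -- `R` is not almost isomorphic to a coherent module
    (∀ P : ModuleCat.{0} PVDExample.R, IsCoherentModule PVDExample.R P →
      ¬ AlmostMath.AlmostIsomorphic PVDExample.𝔪
        P (ModuleCat.of PVDExample.R PVDExample.R)) ∧
    -- nor can it be approximated by coherent modules, up to finitely generated `𝔪₀ ⊆ 𝔪`
    ¬ (∀ 𝔪₀ : Ideal PVDExample.R, 𝔪₀ ≤ PVDExample.𝔪 → 𝔪₀.FG →
      ∃ (N : ModuleCat.{0} PVDExample.R) (f : N →ₗ[PVDExample.R] PVDExample.R),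
        IsCoherentModule PVDExample.R N ∧
        𝔪₀ • LinearMap.ker f = ⊥ ∧
        𝔪₀ • (⊤ : Submodule PVDExample.R (PVDExample.R ⧸ LinearMap.range f)) = ⊥) := by
  refine ⟨PVDExample.Q_isMaximal, PVDExample.valuationRing_V,
    PVDExample.exists_surjective_valuation_integers, PVDExample.isPseudoValuationDomain_R,
    PVDExample.isLocalRing_R, PVDExample.isMaximal_𝔪, fun P hP hP0 => ?_,
    PVDExample.ringKrullDim_R, PVDExample.not_isCoherentRing_R, PVDExample.not_fg_𝔪,
    PVDExample.𝔪_idempotent.out, PVDExample.flat_𝔪, inferInstance,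
    fun J => (PVDExample.isAlmostFinitelyFree_ideal J).isAlmostFG, PVDExample.isAlmostCoherent_R,
    PVDExample.not_almostIsomorphic_of_isCoherentModule,
    PVDExample.not_forall_exists_coherent_approximation⟩
  exact eq_of_isPrime_of_le_radical PVDExample.isMaximal_𝔪
    (fun _ => PVDExample.𝔪_le_radical_span_singleton) hP hP0
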